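/- For every $\alpha>0$ there exist constants $C'_\alpha, C''_\alpha>0$, depending only on $\alpha$, such that the following holds. For a real random variable $X$ put $\|X\|_{\psi_\alpha}=\inf\{c>0:\ \mathbb E[\exp((|X|/c)^\alpha)-1]\le 1\}\in[0,\infty]$ (with $\inf\emptyset=\infty$), and call $X$ sub-Weibull($\alpha$) if $\|X\|_{\psi_\alpha}<\infty$. Let $n\ge 1$, let $C_X>0$ be a real number, and let $X_1,\dots,X_n$ be independent (not necessarily identically distributed) zero-mean sub-Weibull($\alpha$) random variables on a probability space with $\|X_i\|_{\psi_\alpha}\le C_X$ for each $i=1,\dots,n$. Then for every $\varepsilon\ge 0$, \[ \mathbb P\left(\left|\sum_{i=1}^n X_i\right|\ \ge\ C'_\alpha C_X\sqrt{n}\sqrt{\varepsilon}+C''_\alpha C_X\, n^{\max\{(\alpha-1)/\alpha,\,0\}}\,\varepsilon^{1/\alpha}\right)\le e\exp(-\varepsilon). \] -/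

import Mathlib

open MeasureTheory ProbabilityTheory
open scoped ENNReal

/-- The Young-type function `ψ_α(x) = exp(x^α) - 1`, used for `x ≥ 0`. -/
noncomputable def psiWeibull (α x : ℝ) : ℝ := Real.exp (x ^ α) - 1

/-- The sub-Weibull(`α`) quasi-norm
`‖X‖_{ψ_α} = inf {c > 0 : E[ψ_α(|X| / c)] ≤ 1}`, with values in `[0, ∞]`.
The expectation of the nonnegative variable `ψ_α(|X| / c)` is taken in `[0, ∞]`,
and the infimum of the empty set is `∞`. -/
noncomputable def subWeibullNorm {Ω : Type*} [MeasurableSpace Ω] (α : ℝ) (X : Ω → ℝ)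
    (μ : Measure Ω) : ℝ≥0∞ :=
  ⨅ (c : ℝ) (_ : 0 < c) (_ : ∫⁻ ω, ENNReal.ofReal (psiWeibull α (|X ω| / c)) ∂μ ≤ 1),
    ENNReal.ofReal c

/-- `X` is a sub-Weibull(`α`) random variable: it is (a.e.) measurable and its quasi-norm
is finite. -/
def IsSubWeibull {Ω : Type*} [MeasurableSpace Ω] (α : ℝ) (X : Ω → ℝ) (μ : Measure Ω) : Prop :=
  AEMeasurable X μ ∧ subWeibullNorm α X μ < ∞

/-! After rescaling to `Y` with `E exp(|Y|^α) ≤ 2`, every case is a Chernoff bound with its own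
parameter `l`. For `ε ≤ 1` the claim is trivial, and for `ε ≥ 1` it suffices to reach `4 exp(-2ε)`,
so constants in front cost nothing. If `α ≥ 1`, put `r = ε / n`. For `r ≤ 1` centring gives a
quadratic mgf bound and the `√n √ε` term; for `r ≥ 1` the Young-type `rpow_mul_le_rpow_add` gives
the other term. If `α < 1`, exponential moments may be infinite, so the variables are truncated at
`M = L^(1/α)`. A union bound handles `|Y i| > M`, and below `M` a linear exponent with slope at most
`M^(α-1)/2` is dominated by `|y|^α / 2` (`exp_mul_truncateAbs_le`). -/

/-! ### Scalar inequalities. -/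

theorem exp_le_one_add_add_sq_mul_exp_abs (x : ℝ) :
    Real.exp x ≤ 1 + x + x ^ 2 * Real.exp |x| := by
  have h := Complex.norm_exp_sub_sum_le_norm_mul_exp (x : ℂ) 2
  have e : Complex.exp (x : ℂ) - ∑ m ∈ Finset.range 2, (x : ℂ) ^ m / (m.factorial : ℂ)
      = ((Real.exp x - (1 + x) : ℝ) : ℂ) := by
    simp [Finset.sum_range_succ]
  rw [e, Complex.norm_real, Complex.norm_real, Real.norm_eq_abs, Real.norm_eq_abs, sq_abs] at h
  linarith [le_abs_self (Real.exp x - (1 + x))]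

/-- Raise `x ≤ exp x` to the power `2/α`. Only half of the exponent is spent, leaving the other half
to absorb `exp |s * y|`. -/
theorem sq_le_mul_exp_half_rpow {α : ℝ} (hα : 0 < α) {y : ℝ} (hy : 0 ≤ y) :
    y ^ 2 ≤ (4 / α) ^ (2 / α) * Real.exp (y ^ α / 2) := by
  have hx : 0 ≤ α * y ^ α / 4 := by positivity
  have h1 : α * y ^ α / 4 ≤ Real.exp (α * y ^ α / 4) := by
    linarith [Real.add_one_le_exp (α * y ^ α / 4)]
  have h2 := Real.rpow_le_rpow hx h1 (by positivity : 0 ≤ 2 / α)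
  have h3 : y ^ 2 = (4 / α) ^ (2 / α) * (α * y ^ α / 4) ^ (2 / α) := by
    rw [← Real.mul_rpow (by positivity) hx,
      show 4 / α * (α * y ^ α / 4) = y ^ α by field_simp, ← Real.rpow_mul hy,
      show α * (2 / α) = (2 : ℕ) by field_simp; norm_num, Real.rpow_natCast]
  rw [← Real.exp_mul, show α * y ^ α / 4 * (2 / α) = y ^ α / 2 by field_simp; norm_num] at h2
  rw [h3]
  gcongr

theorem le_one_add_rpow {α y : ℝ} (hα : 1 ≤ α) (hy : 0 ≤ y) : y ≤ 1 + y ^ α := by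
  rcases le_total y 1 with h | h
  · linarith [Real.rpow_nonneg hy α]
  · linarith [Real.self_le_rpow_of_one_le h hα]

theorem rpow_mul_le_rpow_add {α r y : ℝ} (hα : 1 ≤ α) (hr : 0 < r) (hy : 0 ≤ y) :
    r ^ ((α - 1) / α) * y ≤ y ^ α + r := by
  have h0 : 0 < α := by linarith
  have hyα := Real.rpow_nonneg hy α
  rcases le_total y (r ^ (1 / α)) with h | h
  · have : r ^ ((α - 1) / α) * y ≤ r ^ ((α - 1) / α) * r ^ (1 / α) := by gcongr
    rw [← Real.rpow_add hr, show (α - 1) / α + 1 / α = 1 by field_simp; ring, Real.rpow_one] at this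
    linarith
  · have hy0 : 0 < y := lt_of_lt_of_le (by positivity) h
    have h1 : r ^ ((α - 1) / α) ≤ y ^ (α - 1) := by
      have := Real.rpow_le_rpow (by positivity) h (by linarith : 0 ≤ α - 1)
      rwa [← Real.rpow_mul hr.le, show 1 / α * (α - 1) = (α - 1) / α by ring] at this
    have : r ^ ((α - 1) / α) * y ≤ y ^ (α - 1) * y := by gcongr
    rw [← Real.rpow_add_one hy0.ne', sub_add_cancel] at this
    linarith

/-! ### Chernoff bounds for independent sums. -/

section Chernoff

variable {Ω : Type*} [MeasurableSpace Ω] {μ : Measure Ω}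

theorem integrable_exp_mul_and_mgf_le {Z G : Ω → ℝ} {s b : ℝ} (hZ : AEMeasurable Z μ)
    (hG : Integrable G μ) (hle : ∀ ω, Real.exp (s * Z ω) ≤ G ω) (hb : ∫ ω, G ω ∂μ ≤ Real.exp b) :
    Integrable (fun ω ↦ Real.exp (s * Z ω)) μ ∧ mgf Z μ s ≤ Real.exp b := by
  have hi : Integrable (fun ω ↦ Real.exp (s * Z ω)) μ :=
    hG.mono' (hZ.const_mul s).exp.aestronglyMeasurable
      (.of_forall fun ω ↦ by rw [Real.norm_of_nonneg (Real.exp_pos _).le]; exact hle ω)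
  exact ⟨hi, (integral_mono hi hG hle).trans hb⟩

variable [IsProbabilityMeasure μ]

theorem measureReal_le_sum_le {n : ℕ} {Z : Fin n → Ω → ℝ} (hind : iIndepFun Z μ)
    (hZ : ∀ i, AEMeasurable (Z i) μ) {l b : ℝ} (hl : 0 ≤ l)
    (h : ∀ i, Integrable (fun ω ↦ Real.exp (l * Z i ω)) μ ∧ mgf (Z i) μ l ≤ Real.exp b) (t : ℝ) :
    μ.real {ω | t ≤ ∑ i, Z i ω} ≤ Real.exp (n * b - l * t) := by
  have hmgf := hind.mgf_sum₀ (t := l) hZ Finset.univ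
  have hpos : 0 < mgf (∑ i, Z i) μ l := by
    rw [hmgf]
    exact Finset.prod_pos fun i _ ↦ mgf_pos (h i).1
  have hint : Integrable (fun ω ↦ Real.exp (l * (∑ i, Z i) ω)) μ := by
    -- Without integrability `mgf` takes the default value `0`, but the product is positive.
    by_contra hn
    exact hpos.ne' (mgf_undef hn)
  have hle : mgf (∑ i, Z i) μ l ≤ Real.exp (n * b) := by
    rw [hmgf, Real.exp_nat_mul]
    calc ∏ i, mgf (Z i) μ l ≤ ∏ _i : Fin n, Real.exp b :=
          Finset.prod_le_prod (fun i _ ↦ mgf_nonneg) fun i _ ↦ (h i).2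
      _ = _ := by simp
  have hc := measure_ge_le_exp_mul_mgf t hl hint
  simp only [Finset.sum_apply] at hc
  calc _ ≤ _ := hc
    _ ≤ Real.exp (-l * t) * Real.exp (n * b) := by gcongr
    _ = _ := by rw [← Real.exp_add]; ring_nf

theorem measureReal_le_abs_sum_le {n : ℕ} {Z : Fin n → Ω → ℝ} (hind : iIndepFun Z μ)
    (hZ : ∀ i, AEMeasurable (Z i) μ) {l b : ℝ} (hl : 0 ≤ l)
    (h : ∀ s, |s| = l → ∀ i,
      Integrable (fun ω ↦ Real.exp (s * Z i ω)) μ ∧ mgf (Z i) μ s ≤ Real.exp b) (t : ℝ) :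
    μ.real {ω | t ≤ |∑ i, Z i ω|} ≤ 2 * Real.exp (n * b - l * t) := by
  have h1 := measureReal_le_sum_le hind hZ hl (h l (abs_of_nonneg hl)) t
  have h2 := measureReal_le_sum_le (Z := fun i ω ↦ -Z i ω)
    (hind.comp (fun _ x ↦ -x) fun _ ↦ measurable_neg) (fun i ↦ (hZ i).neg) hl (b := b)
    (fun i ↦ by
      have := h (-l) (by rw [abs_neg, abs_of_nonneg hl]) i
      have e : mgf (fun ω ↦ -Z i ω) μ l = mgf (Z i) μ (-l) := by simp [mgf]
      rw [e]
      simpa using this) t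
  have hsub : {ω | t ≤ |∑ i, Z i ω|} ⊆ {ω | t ≤ ∑ i, Z i ω} ∪ {ω | t ≤ ∑ i, -Z i ω} := by
    intro ω hω
    simpa [le_abs] using hω
  linarith [(measureReal_mono hsub).trans (measureReal_union_le (μ := μ) _ _)]

end Chernoff

theorem four_mul_exp_neg_two_mul_le {ε : ℝ} (hε : 1 ≤ ε) :
    4 * Real.exp (-2 * ε) ≤ Real.exp 1 * Real.exp (-ε) := by
  have h1 : Real.exp (-2 * ε) ≤ Real.exp (-1) * Real.exp (-ε) := by
    rw [← Real.exp_add]; exact Real.exp_le_exp.2 (by linarith)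
  have h2 : 4 * Real.exp (-1) ≤ Real.exp 1 := by
    rw [Real.exp_neg, ← div_eq_mul_inv, div_le_iff₀ (Real.exp_pos 1)]
    nlinarith [Real.exp_one_gt_d9]
  nlinarith [Real.exp_pos (-ε), mul_le_mul_of_nonneg_right h2 (Real.exp_pos (-ε)).le]

/-! ### Moments of a normalised variable, and the case `1 ≤ α`. -/

section Tail

variable {Ω : Type*} [MeasurableSpace Ω] {μ : Measure Ω}

theorem integrable_of_integrable_exp_abs_rpow {α : ℝ} (hα : 0 < α) {Y : Ω → ℝ}
    (hY : AEMeasurable Y μ) (hint : Integrable (fun ω ↦ Real.exp (|Y ω| ^ α)) μ) :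
    Integrable Y μ := by
  refine (hint.const_mul (1 + (4 / α) ^ (2 / α))).mono' hY.aestronglyMeasurable
    (.of_forall fun ω ↦ ?_)
  have h := sq_le_mul_exp_half_rpow hα (abs_nonneg (Y ω))
  have h1 : (1 : ℝ) ≤ Real.exp (|Y ω| ^ α) := Real.one_le_exp (by positivity)
  have h2 : Real.exp (|Y ω| ^ α / 2) ≤ Real.exp (|Y ω| ^ α) :=
    Real.exp_le_exp.2 (by linarith [Real.rpow_nonneg (abs_nonneg (Y ω)) α])
  have h3 := mul_le_mul_of_nonneg_left h2 (by positivity : 0 ≤ (4 / α) ^ (2 / α))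
  rw [Real.norm_eq_abs]
  nlinarith [sq_nonneg (|Y ω| - 1)]

variable [IsProbabilityMeasure μ]

theorem integral_one_add_mul_add_le {Y E : Ω → ℝ} (hY : Integrable Y μ) (hE : Integrable E μ)
    (h0 : ∫ ω, Y ω ∂μ = 0) (h2 : ∫ ω, E ω ∂μ ≤ 2) (s : ℝ) {a : ℝ} (ha : 0 ≤ a) :
    Integrable (fun ω ↦ 1 + s * Y ω + a * E ω) μ ∧
      ∫ ω, (1 + s * Y ω + a * E ω) ∂μ ≤ Real.exp (2 * a) := by
  have i1 : Integrable (fun ω ↦ 1 + s * Y ω) μ := (integrable_const 1).add (hY.const_mul s)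
  refine ⟨i1.add (hE.const_mul a), ?_⟩
  rw [integral_add i1 (hE.const_mul a), integral_add (integrable_const 1) (hY.const_mul s),
    integral_const_mul, integral_const_mul, h0]
  simp only [integral_const, probReal_univ, smul_eq_mul, mul_one, mul_zero, add_zero]
  nlinarith [Real.add_one_le_exp (2 * a)]

theorem measureReal_abs_sum_le_of_one_le {α : ℝ} (hα : 1 ≤ α) {n : ℕ} (hn : 1 ≤ n)
    {Y : Fin n → Ω → ℝ} (hind : iIndepFun Y μ) (hY : ∀ i, AEMeasurable (Y i) μ)
    (hint : ∀ i, Integrable (fun ω ↦ Real.exp (|Y i ω| ^ α)) μ)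
    (h2 : ∀ i, ∫ ω, Real.exp (|Y i ω| ^ α) ∂μ ≤ 2) (h0 : ∀ i, ∫ ω, Y i ω ∂μ = 0)
    {ε : ℝ} (hε : 1 ≤ ε) :
    μ.real {ω | 32 * √(n : ℝ) * √ε + 4 * (n : ℝ) ^ ((α - 1) / α) * ε ^ (1 / α) ≤ |∑ i, Y i ω|}
      ≤ Real.exp 1 * Real.exp (-ε) := by
  have hα0 : 0 < α := by linarith
  have hn0 : (0 : ℝ) < n := by exact_mod_cast hn
  have hε0 : 0 < ε := by linarith
  refine le_trans ?_ (four_mul_exp_neg_two_mul_le hε)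
  have fin : ∀ {x : ℝ}, x ≤ -2 * ε → 2 * Real.exp x ≤ 4 * Real.exp (-2 * ε) := fun hx ↦ by
    linarith [Real.exp_le_exp.2 hx, Real.exp_pos (-2 * ε)]
  set r := ε / n with hr
  have hr0 : 0 < r := by positivity
  have hnr : n * r = ε := by rw [hr]; field_simp
  have hA : 0 ≤ 32 * √(n : ℝ) * √ε := by positivity
  have hB : 0 ≤ 4 * (n : ℝ) ^ ((α - 1) / α) * ε ^ (1 / α) := by positivity
  rcases le_total r 1 with h | h
  -- Since `l ≤ 1/2`, both `exp |s * y|` and `y ^ 2` cost a factor `exp (|y| / 2)`, and `|y| ≤ 1 +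
  -- |y|^α`.
  · refine (measureReal_le_abs_sum_le hind hY (l := √r / 2) (b := 4 * Real.exp 1 * r)
      (by positivity) ?_ _).trans (fin ?_)
    · intro s hs i
      have hsr : s ^ 2 = r / 4 := by
        rw [← sq_abs, hs, div_pow, Real.sq_sqrt hr0.le]; norm_num
      obtain ⟨hG, hGb⟩ := integral_one_add_mul_add_le
        (integrable_of_integrable_exp_abs_rpow hα0 (hY i) (hint i)) (hint i) (h0 i) (h2 i) s
        (a := 2 * Real.exp 1 * r) (by positivity)
      refine integrable_exp_mul_and_mgf_le (hY i) hG (fun ω ↦ ?_) (hGb.trans_eq (by ring_nf))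
      have hy := abs_nonneg (Y i ω)
      have e1 := exp_le_one_add_add_sq_mul_exp_abs (s * Y i ω)
      have e2 : Real.exp |s * Y i ω| ≤ Real.exp (|Y i ω| / 2) := by
        refine Real.exp_le_exp.2 ?_
        rw [abs_mul, hs]
        nlinarith [Real.sqrt_le_one.2 h]
      have e3 : (Y i ω) ^ 2 ≤ 8 * Real.exp (|Y i ω| / 2) := by
        have := Real.quadratic_le_exp_of_nonneg (by positivity : 0 ≤ |Y i ω| / 2)
        rw [← sq_abs]
        nlinarith
      have e4 : Real.exp (|Y i ω| / 2) * Real.exp (|Y i ω| / 2)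
          ≤ Real.exp 1 * Real.exp (|Y i ω| ^ α) := by
        rw [← Real.exp_add, ← Real.exp_add, add_halves]
        exact Real.exp_le_exp.2 (le_one_add_rpow hα hy)
      have e5 : (s * Y i ω) ^ 2 * Real.exp |s * Y i ω|
          ≤ r / 4 * (8 * Real.exp (|Y i ω| / 2)) * Real.exp (|Y i ω| / 2) := by
        rw [mul_pow, hsr]
        gcongr
      have e6 := mul_le_mul_of_nonneg_left e4 (by positivity : 0 ≤ 2 * r)
      linarith
    · have hs : √r * √(n : ℝ) = √ε := by rw [← Real.sqrt_mul hr0.le, mul_comm, hnr]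
      have hl : √r / 2 * (32 * √(n : ℝ) * √ε) = 16 * ε := by
        rw [show √r / 2 * (32 * √(n : ℝ) * √ε) = 16 * (√r * √(n : ℝ)) * √ε by ring, hs, mul_assoc,
          Real.mul_self_sqrt hε0.le]
      have hl2 := mul_nonneg (by positivity : 0 ≤ √r / 2) hB
      rw [mul_add, hl, show n * (4 * Real.exp 1 * r) = 4 * Real.exp 1 * (n * r) by ring, hnr]
      nlinarith [Real.exp_one_lt_d9]
  -- Centring plays no role here: the moment factor `2` is at most `exp r` because `r ≥ 1`.
  · refine (measureReal_le_abs_sum_le hind hY (l := r ^ ((α - 1) / α)) (b := 2 * r)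
      (by positivity) ?_ _).trans (fin ?_)
    · intro s hs i
      refine integrable_exp_mul_and_mgf_le (G := fun ω ↦ Real.exp r * Real.exp (|Y i ω| ^ α))
        (hY i) ((hint i).const_mul _) (fun ω ↦ ?_) ?_
      · rw [← Real.exp_add]
        refine Real.exp_le_exp.2 ((le_abs_self _).trans ?_)
        rw [abs_mul, hs, add_comm]
        exact rpow_mul_le_rpow_add hα hr0 (abs_nonneg _)
      · rw [integral_const_mul, two_mul, Real.exp_add]
        gcongr
        linarith [h2 i, Real.add_one_le_exp r]
    · have hl : r ^ ((α - 1) / α) * (4 * (n : ℝ) ^ ((α - 1) / α) * ε ^ (1 / α)) = 4 * ε := by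
        rw [show r ^ ((α - 1) / α) * (4 * (n : ℝ) ^ ((α - 1) / α) * ε ^ (1 / α))
            = 4 * ((n : ℝ) ^ ((α - 1) / α) * r ^ ((α - 1) / α) * ε ^ (1 / α)) by ring,
          ← Real.mul_rpow hn0.le hr0.le, hnr, ← Real.rpow_add hε0,
          show (α - 1) / α + 1 / α = 1 by field_simp; ring, Real.rpow_one]
      have hl2 := mul_nonneg (by positivity : 0 ≤ r ^ ((α - 1) / α)) hA
      rw [mul_add, hl, show n * (2 * r) = 2 * (n * r) by ring, hnr]
      linarith

/-! ### Truncation and the case `α < 1`. -/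

/-- Truncation of a real number at level `M`. -/
noncomputable def truncateAbs (M x : ℝ) : ℝ := if |x| ≤ M then x else 0

theorem measurable_truncateAbs (M : ℝ) : Measurable (truncateAbs M) :=
  Measurable.ite (measurableSet_le measurable_norm measurable_const) measurable_id measurable_const

/-- The linear term keeps the untruncated `y`, so it integrates to zero although the truncation is
not centred. The price is `|s * y|` on `|y| > M`, where `|y|^α ≥ L` makes it exponentially small. -/
theorem exp_mul_truncateAbs_le {α : ℝ} (hα : 0 < α) (hα1 : α ≤ 1) {L s : ℝ} (hL : 0 < L)
    (hs : |s| ≤ (L ^ (1 / α)) ^ (α - 1) / 2) (y : ℝ) :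
    Real.exp (s * truncateAbs (L ^ (1 / α)) y) ≤
      1 + s * y + (1 + (4 / α) ^ (2 / α)) * (s ^ 2 + |s| * Real.exp (-(L / 2)))
        * Real.exp (|y| ^ α) := by
  set M := L ^ (1 / α) with hM
  set K := (4 / α) ^ (2 / α) with hK
  have hM0 : 0 < M := by positivity
  have hMα : M ^ α = L := by rw [hM, ← Real.rpow_mul hL.le]; field_simp; simp
  have hK0 : 0 ≤ K := by positivity
  have hy := abs_nonneg y
  have hsq : y ^ 2 ≤ K * Real.exp (|y| ^ α / 2) := by
    rw [← sq_abs]; exact sq_le_mul_exp_half_rpow hα hy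
  have hE : Real.exp (|y| ^ α / 2) * Real.exp (|y| ^ α / 2) = Real.exp (|y| ^ α) := by
    rw [← Real.exp_add, add_halves]
  have p1 : 0 ≤ s ^ 2 * Real.exp (|y| ^ α) := by positivity
  have p2 : 0 ≤ |s| * Real.exp (-(L / 2)) * Real.exp (|y| ^ α) := by positivity
  have p3 := mul_nonneg hK0 p1
  have p4 := mul_nonneg hK0 p2
  unfold truncateAbs
  split_ifs with h
  · have e1 := exp_le_one_add_add_sq_mul_exp_abs (s * y)
    have e2 : |s * y| ≤ |y| ^ α / 2 := by
      rcases hy.eq_or_lt with h0 | h0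
      · rw [abs_mul, ← h0, mul_zero]; positivity
      have m : M ^ (α - 1) ≤ |y| ^ (α - 1) :=
        Real.rpow_le_rpow_of_nonpos h0 h (by linarith)
      have : |y| ^ (α - 1) * |y| = |y| ^ α := by rw [← Real.rpow_add_one h0.ne', sub_add_cancel]
      rw [abs_mul]
      nlinarith
    have e3 : (s * y) ^ 2 * Real.exp |s * y|
        ≤ s ^ 2 * (K * Real.exp (|y| ^ α / 2)) * Real.exp (|y| ^ α / 2) := by
      rw [mul_pow]
      gcongr
    have e4 : s ^ 2 * (K * Real.exp (|y| ^ α / 2)) * Real.exp (|y| ^ α / 2)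
        = K * (s ^ 2 * Real.exp (|y| ^ α)) := by rw [← hE]; ring
    nlinarith
  · push Not at h
    have hLy : L ≤ |y| ^ α := by rw [← hMα]; exact Real.rpow_le_rpow hM0.le h.le hα.le
    have e1 : Real.exp (|y| ^ α / 2) ≤ Real.exp (-(L / 2)) * Real.exp (|y| ^ α) := by
      rw [← Real.exp_add]; exact Real.exp_le_exp.2 (by linarith)
    have e2 : |y| ≤ (1 + K) * Real.exp (|y| ^ α / 2) := by
      have : (1 : ℝ) ≤ Real.exp (|y| ^ α / 2) := Real.one_le_exp (by positivity)
      rw [← sq_abs] at hsq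
      nlinarith [sq_nonneg (|y| - 1)]
    have e3 : |s| * |y| ≤ |s| * ((1 + K) * (Real.exp (-(L / 2)) * Real.exp (|y| ^ α))) := by
      gcongr
      exact e2.trans (by gcongr)
    have e4 := neg_abs_le (s * y)
    rw [abs_mul] at e4
    rw [mul_zero, Real.exp_zero]
    nlinarith

theorem measureReal_lt_abs_le {α : ℝ} (hα : 0 < α) {Y : Ω → ℝ}
    (hint : Integrable (fun ω ↦ Real.exp (|Y ω| ^ α)) μ)
    (h2 : ∫ ω, Real.exp (|Y ω| ^ α) ∂μ ≤ 2) {L : ℝ} (hL : 0 < L) :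
    μ.real {ω | L ^ (1 / α) < |Y ω|} ≤ 2 * Real.exp (-L) := by
  have h := mul_meas_ge_le_integral_of_nonneg
    (.of_forall fun ω ↦ (Real.exp_pos (|Y ω| ^ α)).le) hint (Real.exp L)
  have hsub : {ω | L ^ (1 / α) < |Y ω|} ⊆ {ω | Real.exp L ≤ Real.exp (|Y ω| ^ α)} := by
    intro ω hω
    have := Real.rpow_le_rpow (by positivity) (le_of_lt hω) hα.le
    rw [← Real.rpow_mul hL.le, one_div_mul_cancel hα.ne', Real.rpow_one] at this
    exact Real.exp_le_exp.2 this
  refine (measureReal_mono hsub).trans ?_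
  rw [Real.exp_neg, ← div_eq_mul_inv, le_div_iff₀ (Real.exp_pos L)]
  linarith

/-- The truncation level used for sums of `n` variables with heavy tails, raised to the power `α`:
it dominates `ε` and `log n`. -/
noncomputable def truncationExponent (α : ℝ) (n : ℕ) (ε : ℝ) : ℝ :=
  4 / (α / (2 - α)) * max ε ((n : ℝ) ^ (α / (2 - α)))

theorem truncationExponent_bounds {α : ℝ} (hα : 0 < α) (hα1 : α < 1) {n : ℕ} (hn : 1 ≤ n)
    {ε : ℝ} (hε : 1 ≤ ε) :
    4 * ε ≤ truncationExponent α n ε ∧ (n : ℝ) ≤ Real.exp (truncationExponent α n ε / 4) := by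
  have hn0 : (0 : ℝ) < n := by exact_mod_cast hn
  unfold truncationExponent
  set δ := α / (2 - α) with hδ
  have hδ0 : 0 < δ := div_pos hα (by linarith)
  have hδ1 : δ ≤ 1 := by rw [hδ, div_le_one (by linarith)]; linarith
  have h4 : 4 ≤ 4 / δ := by rw [le_div_iff₀ hδ0]; linarith
  constructor
  · exact mul_le_mul h4 (le_max_left _ _) (by linarith) (by positivity)
  · rw [← Real.log_le_iff_le_exp hn0]
    refine (Real.log_le_rpow_div hn0.le hδ0).trans ?_
    rw [show 4 / δ * max ε ((n : ℝ) ^ δ) / 4 = max ε ((n : ℝ) ^ δ) / δ by ring]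
    gcongr
    exact le_max_right _ _

/-- The exponent `δ = α / (2 - α)` solves `δ (1/α - 1) + δ/2 = 1/2`, so when `n^δ` is the maximum it
contributes exactly `√n √ε`. Truncating with `n^δ` instead of `log n` thus leaves no logarithm. -/
theorem truncationExponent_rpow_mul_le {α : ℝ} (hα : 0 < α) (hα1 : α < 1) {n : ℕ} (hn : 1 ≤ n)
    {ε : ℝ} (hε : 1 ≤ ε) :
    (truncationExponent α n ε ^ (1 / α)) ^ (1 - α) * ε ≤
      (4 / (α / (2 - α))) ^ (1 / α - 1) * (√(n : ℝ) * √ε + ε ^ (1 / α)) := by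
  have hn0 : (0 : ℝ) < n := by exact_mod_cast hn
  have hε0 : 0 < ε := by linarith
  unfold truncationExponent
  set δ := α / (2 - α) with hδ
  have h2α : 2 - α ≠ 0 := by linarith
  have hδ0 : 0 < δ := div_pos hα (by linarith)
  have hm : 0 < max ε ((n : ℝ) ^ δ) := lt_max_of_lt_left hε0
  rw [← Real.rpow_mul (by positivity), show 1 / α * (1 - α) = 1 / α - 1 by field_simp,
    Real.mul_rpow (by positivity) hm.le, mul_assoc]
  gcongr
  have q1 : 0 ≤ √(n : ℝ) * √ε := by positivity
  have q2 : 0 ≤ ε ^ (1 / α) := by positivity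
  rcases le_total ((n : ℝ) ^ δ) ε with h | h
  · rw [max_eq_left h, ← Real.rpow_add_one hε0.ne', sub_add_cancel]
    linarith
  · rw [max_eq_right h]
    have e1 : ε ≤ (n : ℝ) ^ (δ / 2) * √ε := by
      have : √ε ≤ (n : ℝ) ^ (δ / 2) := by
        refine (Real.sqrt_le_sqrt h).trans_eq ?_
        rw [Real.sqrt_eq_rpow, ← Real.rpow_mul hn0.le]
        ring_nf
      calc ε = √ε * √ε := (Real.mul_self_sqrt hε0.le).symm
        _ ≤ _ := by gcongr
    have e2 : ((n : ℝ) ^ δ) ^ (1 / α - 1) * (n : ℝ) ^ (δ / 2) = √(n : ℝ) := by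
      rw [← Real.rpow_mul hn0.le, ← Real.rpow_add hn0, Real.sqrt_eq_rpow]
      congr 1
      rw [hδ]
      field_simp
      ring
    calc ((n : ℝ) ^ δ) ^ (1 / α - 1) * ε
        ≤ ((n : ℝ) ^ δ) ^ (1 / α - 1) * ((n : ℝ) ^ (δ / 2) * √ε) := by gcongr
      _ = √(n : ℝ) * √ε := by rw [← mul_assoc, e2]
      _ ≤ _ := by linarith

/-- The constant in the tail bound for sums of variables with `α < 1`. -/
noncomputable def heavyTailConst (α : ℝ) : ℝ :=
  2 * (4 * (1 + (4 / α) ^ (2 / α)) + 2) * (4 / (α / (2 - α))) ^ (1 / α - 1)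

theorem heavyTailConst_ge {α : ℝ} (hα : 0 < α) (hα1 : α < 1) :
    4 * (1 + (4 / α) ^ (2 / α)) + 2 ≤ heavyTailConst α := by
  have hδ0 : 0 < α / (2 - α) := div_pos hα (by linarith)
  have hδ1 : α / (2 - α) ≤ 1 := by rw [div_le_one (by linarith)]; linarith
  have h4 : 1 ≤ 4 / (α / (2 - α)) := by rw [le_div_iff₀ hδ0]; linarith
  have h1 : 1 ≤ (4 / (α / (2 - α))) ^ (1 / α - 1) :=
    Real.one_le_rpow h4 (by rw [sub_nonneg, le_div_iff₀ hα]; linarith)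
  have : 0 ≤ (4 / α) ^ (2 / α) := by positivity
  unfold heavyTailConst
  nlinarith

theorem measureReal_abs_sum_le_of_lt_one {α : ℝ} (hα : 0 < α) (hα1 : α < 1) {n : ℕ} (hn : 1 ≤ n)
    {Y : Fin n → Ω → ℝ} (hind : iIndepFun Y μ) (hY : ∀ i, AEMeasurable (Y i) μ)
    (hint : ∀ i, Integrable (fun ω ↦ Real.exp (|Y i ω| ^ α)) μ)
    (h2 : ∀ i, ∫ ω, Real.exp (|Y i ω| ^ α) ∂μ ≤ 2) (h0 : ∀ i, ∫ ω, Y i ω ∂μ = 0)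
    {ε : ℝ} (hε : 1 ≤ ε) :
    μ.real {ω | heavyTailConst α * √(n : ℝ) * √ε + heavyTailConst α * ε ^ (1 / α)
        ≤ |∑ i, Y i ω|} ≤ Real.exp 1 * Real.exp (-ε) := by
  have hn0 : (0 : ℝ) < n := by exact_mod_cast hn
  have hε0 : 0 < ε := by linarith
  obtain ⟨hL4, hLn⟩ := truncationExponent_bounds hα hα1 hn hε
  have hLt := truncationExponent_rpow_mul_le hα hα1 hn hε
  have hH := heavyTailConst_ge hα hα1
  set L := truncationExponent α n ε with hLdef
  have hL0 : 0 < L := by linarith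
  set M := L ^ (1 / α) with hM
  have hM1 : 1 ≤ M := Real.one_le_rpow (by linarith) (by positivity)
  have hM0 : 0 < M := by linarith
  set C := 1 + (4 / α) ^ (2 / α) with hC
  have hC0 : 0 < C := by positivity
  set t := heavyTailConst α * √(n : ℝ) * √ε + heavyTailConst α * ε ^ (1 / α) with ht
  set l := min √(ε / n) (M ^ (α - 1) / 2) with hl
  have hl0 : 0 < l := lt_min (by positivity) (by positivity)
  have hl1 : l ≤ 1 := by
    have : M ^ (α - 1) ≤ 1 := Real.rpow_le_one_of_one_le_of_nonpos hM1 (by linarith)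
    linarith [min_le_right √(ε / n) (M ^ (α - 1) / 2)]
  have hlsq : n * l ^ 2 ≤ ε := by
    have : l ^ 2 ≤ ε / n := by
      rw [← Real.sq_sqrt (by positivity : 0 ≤ ε / n)]
      exact pow_le_pow_left₀ hl0.le (min_le_left _ _) 2
    calc n * l ^ 2 ≤ n * (ε / n) := by gcongr
      _ = ε := by field_simp
  have hnexp : n * Real.exp (-(L / 2)) ≤ 1 := by
    calc n * Real.exp (-(L / 2)) ≤ Real.exp (L / 4) * Real.exp (-(L / 2)) := by gcongr
      _ = Real.exp (L / 4 + -(L / 2)) := (Real.exp_add _ _).symm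
      _ ≤ 1 := Real.exp_le_one_iff.2 (by linarith)
  -- `4 * C * ε` pays for the mgf bound `hna`; the remaining `2 * ε` is the decay rate.
  have hlt : (4 * C + 2) * ε ≤ l * t := by
    have q1 : 0 ≤ heavyTailConst α * ε ^ (1 / α) :=
      mul_nonneg (by linarith) (by positivity)
    rcases min_choice √(ε / n) (M ^ (α - 1) / 2) with h | h
    · have e1 : √(ε / n) * √(n : ℝ) = √ε := by
        rw [← Real.sqrt_mul (by positivity), div_mul_cancel₀ _ hn0.ne']
      have e2 : √(ε / n) * (heavyTailConst α * √(n : ℝ) * √ε) = heavyTailConst α * ε := by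
        rw [show √(ε / n) * (heavyTailConst α * √(n : ℝ) * √ε)
          = heavyTailConst α * (√(ε / n) * √(n : ℝ)) * √ε by ring, e1, mul_assoc,
          Real.mul_self_sqrt hε0.le]
      rw [hl, h, ht]
      nlinarith [mul_nonneg (Real.sqrt_nonneg (ε / n)) q1]
    · have e1 : M ^ (α - 1) * M ^ (1 - α) = 1 := by
        rw [← Real.rpow_add hM0]; simp
      have e2 : 2 * (4 * C + 2) * (M ^ (1 - α) * ε) ≤ t := by
        rw [ht]
        unfold heavyTailConst
        rw [← hC]
        nlinarith
      rw [hl, h]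
      calc (4 * C + 2) * ε = M ^ (α - 1) * M ^ (1 - α) * ((4 * C + 2) * ε) := by
            rw [e1, one_mul]
        _ = M ^ (α - 1) / 2 * (2 * (4 * C + 2) * (M ^ (1 - α) * ε)) := by ring
        _ ≤ _ := by gcongr
  set a := C * (l ^ 2 + l * Real.exp (-(L / 2))) with ha
  have ha0 : 0 ≤ a := by positivity
  have hna : n * (2 * a) ≤ 4 * C * ε := by
    have : l * (n * Real.exp (-(L / 2))) ≤ 1 := by
      have : 0 ≤ n * Real.exp (-(L / 2)) := by positivity
      nlinarith
    have := mul_le_mul_of_nonneg_left (add_le_add hlsq this) (by positivity : 0 ≤ 2 * C)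
    rw [ha]
    nlinarith
  have hbulk : μ.real {ω | t ≤ |∑ i, truncateAbs M (Y i ω)|} ≤ 2 * Real.exp (-2 * ε) := by
    refine (measureReal_le_abs_sum_le (Z := fun i ω ↦ truncateAbs M (Y i ω))
      (hind.comp (fun _ ↦ truncateAbs M) fun _ ↦ measurable_truncateAbs M)
      (fun i ↦ (measurable_truncateAbs M).comp_aemeasurable (hY i)) hl0.le (b := 2 * a)
      (fun s hs i ↦ ?_) t).trans ?_
    · obtain ⟨hG, hGb⟩ := integral_one_add_mul_add_le
        (integrable_of_integrable_exp_abs_rpow hα (hY i) (hint i)) (hint i) (h0 i) (h2 i) s ha0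
      refine integrable_exp_mul_and_mgf_le
        ((measurable_truncateAbs M).comp_aemeasurable (hY i)) hG (fun ω ↦ ?_) hGb
      have := exp_mul_truncateAbs_le hα hα1.le hL0
        (s := s) (by rw [hs]; exact min_le_right _ _) (Y i ω)
      rwa [← sq_abs, hs] at this
    · gcongr
      linarith
  have htail : μ.real (⋃ i, {ω | M < |Y i ω|}) ≤ 2 * Real.exp (-2 * ε) := by
    calc μ.real (⋃ i, {ω | M < |Y i ω|}) ≤ ∑ i, μ.real {ω | M < |Y i ω|} :=
          measureReal_iUnion_fintype_le _
      _ ≤ ∑ _i : Fin n, 2 * Real.exp (-L) :=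
          Finset.sum_le_sum fun i _ ↦ measureReal_lt_abs_le hα (hint i) (h2 i) hL0
      _ = 2 * (n * Real.exp (-L)) := by simp; ring
      _ ≤ 2 * (Real.exp (L / 4) * Real.exp (-L)) := by gcongr
      _ ≤ _ := by
          rw [← Real.exp_add]
          gcongr
          linarith
  have hsub : {ω | t ≤ |∑ i, Y i ω|} ⊆
      {ω | t ≤ |∑ i, truncateAbs M (Y i ω)|} ∪ ⋃ i, {ω | M < |Y i ω|} := by
    intro ω hω
    by_cases h : ∃ i, M < |Y i ω|
    · exact Or.inr (Set.mem_iUnion.2 h)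
    · push Not at h
      left
      have : ∑ i, truncateAbs M (Y i ω) = ∑ i, Y i ω :=
        Finset.sum_congr rfl fun i _ ↦ if_pos (h i)
      simpa only [Set.mem_ofPred_eq, this] using hω
  linarith [(measureReal_mono hsub).trans (measureReal_union_le (μ := μ) _ _),
    four_mul_exp_neg_two_mul_le hε]

/-! ### From the quasi-norm to exponential moments, and assembly. -/

theorem exp_abs_rpow_of_subWeibullNorm_lt {α : ℝ} (hα : 0 < α) {X : Ω → ℝ}
    (hX : AEMeasurable X μ) {K : ℝ} (hK : subWeibullNorm α X μ < ENNReal.ofReal K) :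
    Integrable (fun ω ↦ Real.exp (|X ω / K| ^ α)) μ ∧
      ∫ ω, Real.exp (|X ω / K| ^ α) ∂μ ≤ 2 := by
  simp only [subWeibullNorm, iInf_lt_iff] at hK
  obtain ⟨c, hc, hc1, hcK⟩ := hK
  have hcK' : c < K := (ENNReal.ofReal_lt_ofReal_iff_of_nonneg hc.le).1 hcK
  have hK0 : 0 < K := hc.trans hcK'
  have hmeas : AEMeasurable (fun ω ↦ Real.exp (|X ω / K| ^ α)) μ :=
    ((hX.div_const K).abs.pow_const α).exp
  have hlin : ∫⁻ ω, ENNReal.ofReal (Real.exp (|X ω / K| ^ α)) ∂μ ≤ 2 := by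
    calc ∫⁻ ω, ENNReal.ofReal (Real.exp (|X ω / K| ^ α)) ∂μ
        ≤ ∫⁻ ω, (1 + ENNReal.ofReal (psiWeibull α (|X ω| / c))) ∂μ := by
          refine lintegral_mono fun ω ↦ ?_
          have h : |X ω / K| ^ α ≤ (|X ω| / c) ^ α := by
            rw [abs_div, abs_of_pos hK0]
            gcongr
          rw [← ENNReal.ofReal_one, ← ENNReal.ofReal_add zero_le_one
            (by unfold psiWeibull; linarith [Real.one_le_exp (by positivity : 0 ≤ (|X ω| / c) ^ α)])]
          refine ENNReal.ofReal_le_ofReal ?_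
          unfold psiWeibull
          linarith [Real.exp_le_exp.2 h]
      _ = 1 + ∫⁻ ω, ENNReal.ofReal (psiWeibull α (|X ω| / c)) ∂μ := by
          rw [lintegral_add_left measurable_const]; simp
      _ ≤ 1 + 1 := by gcongr
      _ = 2 := one_add_one_eq_two
  have hnn : ∀ ω, 0 ≤ Real.exp (|X ω / K| ^ α) := fun ω ↦ (Real.exp_pos _).le
  refine ⟨⟨hmeas.aestronglyMeasurable, ?_⟩, ?_⟩
  · rw [hasFiniteIntegral_iff_ofReal (.of_forall hnn)]
    exact hlin.trans_lt (by simp)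
  · rw [integral_eq_lintegral_of_nonneg_ae (.of_forall hnn) hmeas.aestronglyMeasurable]
    exact ENNReal.toReal_le_of_le_ofReal zero_le_two (by simpa using hlin)

end Tail

theorem exists_tail_bound_of_integral_exp_le_two (α : ℝ) (hα : 0 < α) :
    ∃ A B : ℝ, 0 < A ∧ 0 < B ∧
      ∀ {Ω : Type*} [MeasurableSpace Ω] (μ : Measure Ω) [IsProbabilityMeasure μ]
        (n : ℕ) (_ : 1 ≤ n) (Y : Fin n → Ω → ℝ), iIndepFun Y μ → (∀ i, AEMeasurable (Y i) μ) →
        (∀ i, Integrable (fun ω ↦ Real.exp (|Y i ω| ^ α)) μ) →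
        (∀ i, ∫ ω, Real.exp (|Y i ω| ^ α) ∂μ ≤ 2) → (∀ i, ∫ ω, Y i ω ∂μ = 0) →
        ∀ ε : ℝ, 1 ≤ ε → μ.real {ω | A * √(n : ℝ) * √ε
          + B * (n : ℝ) ^ (max ((α - 1) / α) 0) * ε ^ (1 / α) ≤ |∑ i, Y i ω|}
          ≤ Real.exp 1 * Real.exp (-ε) := by
  rcases le_or_gt 1 α with h1 | h1
  · refine ⟨32, 4, by norm_num, by norm_num, ?_⟩
    intro Ω _ μ _ n hn Y hind hY hint h2 h0 ε hε
    rw [max_eq_left (div_nonneg (by linarith) hα.le)]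
    exact measureReal_abs_sum_le_of_one_le h1 hn hind hY hint h2 h0 hε
  · have hH : 0 < heavyTailConst α := lt_of_lt_of_le (by positivity) (heavyTailConst_ge hα h1)
    refine ⟨heavyTailConst α, heavyTailConst α, hH, hH, ?_⟩
    intro Ω _ μ _ n hn Y hind hY hint h2 h0 ε hε
    rw [max_eq_right (div_nonpos_of_nonpos_of_nonneg (by linarith) hα.le), Real.rpow_zero,
      mul_one]
    exact measureReal_abs_sum_le_of_lt_one hα h1 hn hind hY hint h2 h0 hε

theorem mainTheorem5 (α : ℝ) (hα : 0 < α) :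
    ∃ C' C'' : ℝ, 0 < C' ∧ 0 < C'' ∧
      ∀ {Ω : Type*} [MeasurableSpace Ω] (μ : Measure Ω) [IsProbabilityMeasure μ]
        (n : ℕ) (_ : 1 ≤ n) (X : Fin n → Ω → ℝ) (CX : ℝ) (_ : 0 < CX),
        iIndepFun X μ →
        (∀ i, IsSubWeibull α (X i) μ) →
        (∀ i, ∫ ω, X i ω ∂μ = 0) →
        (∀ i, subWeibullNorm α (X i) μ ≤ ENNReal.ofReal CX) →
        ∀ ε : ℝ, 0 ≤ ε →
          μ.real {ω | |∑ i, X i ω| ≥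
              C' * CX * √(n : ℝ) * √ε
                + C'' * CX * (n : ℝ) ^ (max ((α - 1) / α) 0) * ε ^ (1 / α)}
            ≤ Real.exp 1 * Real.exp (-ε) := by
  obtain ⟨A, B, hA, hB, h⟩ := exists_tail_bound_of_integral_exp_le_two α hα
  -- Rescaling by `2 * CX` makes the norm bound strict, so an admissible `c` exists below it without
  -- showing that the infimum is attained.
  refine ⟨2 * A, 2 * B, by positivity, by positivity, ?_⟩
  intro Ω _ μ _ n hn X CX hCX hind hsub h0 hnorm ε hε
  rcases le_total ε 1 with h1 | h1
  · rw [← Real.exp_add]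
    exact measureReal_le_one.trans (Real.one_le_exp (by linarith))
  have hlt : ∀ i, subWeibullNorm α (X i) μ < ENNReal.ofReal (2 * CX) := fun i ↦
    (hnorm i).trans_lt ((ENNReal.ofReal_lt_ofReal_iff (by positivity)).2 (by linarith))
  have hexp := fun i ↦ exp_abs_rpow_of_subWeibullNorm_lt hα (hsub i).1 (hlt i)
  have key := h μ n hn (fun i ω ↦ X i ω / (2 * CX))
    (hind.comp (fun _ x ↦ x / (2 * CX)) fun _ ↦ measurable_id.div_const _)
    (fun i ↦ (hsub i).1.div_const _) (fun i ↦ (hexp i).1) (fun i ↦ (hexp i).2)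
    (fun i ↦ (integral_div (2 * CX) (X i)).trans (by rw [h0 i, zero_div])) ε h1
  refine (measureReal_mono fun ω hω ↦ ?_).trans key
  simp only [Set.mem_ofPred_eq, ge_iff_le] at hω ⊢
  rw [← Finset.sum_div, abs_div, abs_of_pos (by positivity : 0 < 2 * CX),
    le_div_iff₀ (by positivity)]
  linarith
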